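/- All spaces are real. For a Banach couple $\vec A=(A_0,A_1)$ let $K(t,v;\vec A)=\inf\{\|x\|_{A_0}+t\|y\|_{A_1}: x+y=v\}$. The $K$-divisibility constant $\gamma(\vec A)$ is the infimum of all $C$ such that, whenever $v\in A_0+A_1$ and $K(t,v;\vec A)\le\sum_{n=1}^\infty\varphi_n(t)$ for all $t>0$ with functions $\varphi_n$ that are positive and concave on $(0,\infty)$ and satisfy $\sum_n\varphi_n(1)<\infty$, there are $u_n\in A_0+A_1$ with $v=\sum_n u_n$ (convergence in $A_0+A_1$) and $K(t,u_n;\vec A)\le C\varphi_n(t)$ for all $t>0$ and all $n$. Let $\vec X=(\ell_2^2,\ell_2^\infty)$, i.e. $\mathbb R^2$ with the Euclidean norm and with the maximum norm. For $a>1$ let $w(t)=\dfrac{a+1-2t}{\sqrt{(t-a)^2+(t-1)^2}}$ for $t<1$, $w(t)=1$ for $t\ge1$, let $\vec P=(L^1_w,L^1)$ be the couple of $L^1$ spaces on $(0,a)$ with norms $\int_0^a|h|w$ and $\int_0^a|h|$, let $\mathcal T_a$ be the set of all bounded linear operators $T:\vec P\to\vec X$ with $T\chi_{(0,a)}=(a,1)$,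 and let $c_a=\inf\{\|T\|_{\vec P\to\vec X}:T\in\mathcal T_a\}$, where $\|T\|_{\vec P\to\vec X}$ is the larger of the norms of $T:P_0\to X_0$ and $T:P_1\to X_1$. Call a pair of non-negative functions $g_0,g_1\in L^\infty(0,a)$ optimal if the operator $h\mapsto(\int_0^a hg_0,\int_0^a hg_1)$ belongs to $\mathcal T_a$ and has norm $c_a$; let then $\theta=\arcsin\bigl(g_1/\sqrt{g_0^2+g_1^2}\bigr)$ and $U=\{t\in(0,a):\arccos\frac1{w(t)}<\theta(t)\}$. (1) For every $a>1$ an optimal pair exists, and there is a number $\xi_a\in(0,1)$ such that $$c_a=\frac{a^2+a-2a\xi_a}{a^2-a\xi_a+1-\xi_a}$$ and such that, for every optimal pair, $U=(\xi_a,a)$ up to a null set and $\theta$ has the constant value $\arccos\frac1{w(\xi_a)}$ almost everywhere on $U$. (2) $$\gamma(\vec X)\le\frac{4+3\sqrt2}{4+2\sqrt2}\approx1.2071 .$$ -/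

import Mathlib

open MeasureTheory Filter Topology Set
open scoped ENNReal NNReal

namespace KDiv

noncomputable section

/-- A couple `(A₀, A₁)` of real normed spaces contained in a common real vector space `V`, given by
its two norms as functions on `V`; a norm has the value `∞` outside its space, so that
`A_j = {v | A j v < ∞}`. -/
abbrev Couple (V : Type*) := Fin 2 → V → ℝ≥0∞

section General

variable {V W : Type*} [AddCommGroup V] [Module ℝ V] [AddCommGroup W] [Module ℝ W]

/-- The Peetre functional
`K(t, v; A) = inf {‖x‖_{A₀} + t ‖y‖_{A₁} : x + y = v}`, which is finite exactly on `A₀ + A₁`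
(for `t > 0`). In particular `K(1, ·; A)` is the norm of `A₀ + A₁`. -/
def peetreK (A : Couple V) (t : ℝ) (v : V) : ℝ≥0∞ :=
  ⨅ (x : V) (y : V) (_ : x + y = v), A 0 x + ENNReal.ofReal t * A 1 y

/-- `C` is a constant of `K`-divisibility (for infinite sums) of the couple `A`: whenever
`K(t, v; A) ≤ ∑ φ n t` for all `t > 0`, where the `φ n` are positive and concave on `(0, ∞)` and
`∑ φ n 1 < ∞`, there are elements `u n` with `v = ∑ u n` (convergence in `A₀ + A₁`) and
`K(t, u n; A) ≤ C φ n t` for all `t > 0` and all `n`.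
The vectors `v` and `u n` lie in `A₀ + A₁` because their `K`-functionals are finite. -/
def IsKDivisibilityConstant (A : Couple V) (C : ℝ≥0) : Prop :=
  ∀ (v : V) (φ : ℕ → ℝ → ℝ),
    (∀ n, ∀ t, 0 < t → 0 < φ n t) →
    (∀ n, ConcaveOn ℝ (Ioi 0) (φ n)) →
    Summable (fun n => φ n 1) →
    (∀ t, 0 < t → peetreK A t v ≤ ∑' n, ENNReal.ofReal (φ n t)) →
    ∃ u : ℕ → V,
      Tendsto (fun N => peetreK A 1 (v - ∑ n ∈ Finset.range N, u n)) atTop (𝓝 0) ∧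
      ∀ n, ∀ t, 0 < t → peetreK A t (u n) ≤ C * ENNReal.ofReal (φ n t)

/-- The `K`-divisibility constant `γ(A)`, the infimum of all constants of `K`-divisibility
(`∞` if there are none). -/
def kDivisibility (A : Couple V) : ℝ≥0∞ :=
  ⨅ (C : ℝ≥0) (_ : IsKDivisibilityConstant A C), (C : ℝ≥0∞)

/-- The norm `‖T‖_{A → B}` of a linear operator between couples: the infimum of all `c` with
`‖T v‖_{B_j} ≤ c ‖v‖_{A_j}` for `v ∈ A_j` and `j = 0, 1`. -/
def coupleOpNorm (A : Couple V) (B : Couple W) (T : V →ₗ[ℝ] W) : ℝ≥0∞ :=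
  sInf {c : ℝ≥0∞ | ∀ j v, A j v < ∞ → B j (T v) ≤ c * A j v}

end General

/-- The couple `X = (ℓ₂², ℓ₂^∞)`: the plane with the Euclidean norm and with the maximum norm. -/
def coupleX : Couple (Fin 2 → ℝ) :=
  ![fun x => ‖WithLp.toLp 2 x‖ₑ, fun x => ‖x‖ₑ]

/-- The weight `w`, which is minus the derivative of the error functional
`E(t, (a, 1); X) = inf {‖(a, 1) - β‖_{X₀} : ‖β‖_{X₁} ≤ t}` on `(0, a)`. -/
def weight (a t : ℝ) : ℝ :=
  if t < 1 then (a + 1 - 2 * t) / √((t - a) ^ 2 + (t - 1) ^ 2) else 1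

/-- Lebesgue measure on the interval `(0, a)`. -/
abbrev leb (a : ℝ) : Measure ℝ := volume.restrict (Ioo 0 a)

/-- The couple `P = (L¹_w, L¹)` of weighted `L¹` spaces on `(0, a)`. Since `1 ≤ w ≤ √2` on `(0, a)`,
both spaces and their sum consist of the elements of `L¹(0, a)`. -/
def coupleP (a : ℝ) : Couple (Lp ℝ 1 (leb a)) :=
  ![fun h => ∫⁻ t, ‖h t‖ₑ * ENNReal.ofReal (weight a t) ∂(leb a),
    fun h => ∫⁻ t, ‖h t‖ₑ ∂(leb a)]

/-- The set `𝒯_a` of all bounded linear operators `T : P → X` that map the function which is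
constantly `1` on `(0, a)` to the vector `(a, 1)`. -/
def opSet (a : ℝ) : Set (Lp ℝ 1 (leb a) →ₗ[ℝ] (Fin 2 → ℝ)) :=
  {T | coupleOpNorm (coupleP a) coupleX T < ∞ ∧ T (Lp.const 1 (leb a) (1 : ℝ)) = ![a, 1]}

/-- `c_a = inf {‖T‖_{P → X} : T ∈ 𝒯_a}`. -/
def cConst (a : ℝ) : ℝ≥0∞ := ⨅ T ∈ opSet a, coupleOpNorm (coupleP a) coupleX T

/-- `g₀` and `g₁` are non-negative functions in `L^∞(0, a)`, and the operator
`h ↦ (∫ h g₀, ∫ h g₁)` belongs to `𝒯_a` and has the minimal norm `c_a`. -/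
def IsOptimalPair (a : ℝ) (g₀ g₁ : ℝ → ℝ) : Prop :=
  MemLp g₀ ∞ (leb a) ∧ MemLp g₁ ∞ (leb a) ∧
  (∀ᵐ t ∂(leb a), 0 ≤ g₀ t) ∧ (∀ᵐ t ∂(leb a), 0 ≤ g₁ t) ∧
  ∃ T ∈ opSet a, (∀ h, T h = ![∫ t, h t * g₀ t ∂(leb a), ∫ t, h t * g₁ t ∂(leb a)]) ∧
    coupleOpNorm (coupleP a) coupleX T = cConst a

/-- The polar angle `θ = arcsin (y / ρ)`, `ρ = √(x² + y²)`, of a point `(x, y) ≠ (0, 0)` of the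
closed first quadrant. -/
def polarAngle (x y : ℝ) : ℝ := Real.arcsin (y / √(x ^ 2 + y ^ 2))

/-- The set `U` of all `t ∈ (0, a)` with `arccos (1 / w(t)) < θ(t)`, where `θ` is the polar angle of
`(g₀, g₁)`. -/
def angleSet (a : ℝ) (g₀ g₁ : ℝ → ℝ) : Set ℝ :=
  {t ∈ Ioo 0 a | Real.arccos (1 / weight a t) < polarAngle (g₀ t) (g₁ t)}

end

end KDiv

namespace KDiv

noncomputable section

/-! ### The bound for the constant of `K`-divisibility -/

section Divisibility

/-! Divisibility bound: every piece `u n` can be taken proportional to `v`, with weights `φ n τ / ∑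
φ k τ`, where `τ = ‖v‖₁ / ‖v‖₂`. The functional `v / ‖v‖₂` has dual norms `1` and `τ`, so `K(τ, v) ≥
‖v‖₂` (`norm_le_peetreK_coupleX`). Since `φ n` increases and `φ n t / t` decreases, the loss is at
most the larger of `1` and `‖v‖_∞ ‖v‖₁ / ‖v‖₂²`, which `max_mul_add_le` bounds by `(1 + √2) / 2`.

Minimal operators: this is a linear optimization problem solved by duality. A pair `(g₀, g₁)` of
norm at most `c` takes values at `t` with `g₀ ≤ c` and Euclidean length at most `c * w(t)`. Fix `ξ`
and maximize `g₀ + p * g₁` pointwise, with `p = √(w(ξ)² - 1)` the slope of the corner at `ξ`. As `w`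
decreases, for `t < ξ` the direction `(1, p)` lies below the corner and the maximizer is the corner
`c (1, √(w(t)² - 1))`; for `t > ξ` it is the point of the arc in the fixed direction `(1, p)`. An
intermediate value argument (`exists_switch`) picks `ξ` so that the integral of these maximizers is
proportional to `(a, 1)`. They then define an operator in `opSet a`, and `add_corner_le` shows that
no operator in that set has smaller norm. Equality in the pointwise bound forces uniqueness almost
everywhere (`IsOptimalPair.ae_eq`), and the angle statements are read off from the explicit pair. -/

lemma peetreK_coupleX_le_left (t : ℝ) (v : Fin 2 → ℝ) :
    peetreK coupleX t v ≤ ‖WithLp.toLp 2 v‖ₑ := by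
  refine (iInf₂_le v 0).trans ((iInf_le _ (add_zero v)).trans ?_)
  simp [coupleX]

lemma peetreK_coupleX_le_right (t : ℝ) (v : Fin 2 → ℝ) :
    peetreK coupleX t v ≤ ENNReal.ofReal t * ‖v‖ₑ := by
  refine (iInf₂_le 0 v).trans ((iInf_le _ (zero_add v)).trans ?_)
  simp [coupleX]

lemma peetreK_coupleX_smul_le (t : ℝ) {r : ℝ} (v : Fin 2 → ℝ) :
    peetreK coupleX t (r • v) ≤ ENNReal.ofReal (|r| * min ‖WithLp.toLp 2 v‖ (t * ‖v‖)) := by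
  rw [mul_min_of_nonneg _ _ (abs_nonneg r), ENNReal.ofReal_min]
  refine le_min ((peetreK_coupleX_le_left t _).trans_eq ?_)
    ((peetreK_coupleX_le_right t _).trans_eq ?_)
  · rw [WithLp.toLp_smul, ← ofReal_norm, norm_smul, Real.norm_eq_abs]
  · rw [← ofReal_norm, norm_smul, Real.norm_eq_abs, mul_comm t, ← mul_assoc,
      ENNReal.ofReal_mul (p := |r| * ‖v‖) (by positivity), mul_comm]

lemma norm_toLp_sq (v : Fin 2 → ℝ) : ‖WithLp.toLp 2 v‖ ^ 2 = v 0 ^ 2 + v 1 ^ 2 := by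
  rw [EuclideanSpace.norm_sq_eq]; simp

/-- Euclidean norms are dominated by the `K`-functional at the quotient of the norms. -/
lemma norm_le_peetreK_coupleX {v : Fin 2 → ℝ} (hv : v ≠ 0) :
    ENNReal.ofReal ‖WithLp.toLp 2 v‖ ≤
      peetreK coupleX ((|v 0| + |v 1|) / ‖WithLp.toLp 2 v‖) v := by
  set N := ‖WithLp.toLp 2 v‖ with hN
  have hNpos : 0 < N := norm_pos_iff.2 (by simpa using hv)
  have hN2 : N ^ 2 = v 0 ^ 2 + v 1 ^ 2 := norm_toLp_sq v
  refine le_iInf₂ fun x y => le_iInf fun hxy => ?_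
  simp only [coupleX, Matrix.cons_val_zero, Matrix.cons_val_one]
  rw [← ofReal_norm, ← ofReal_norm, ← ENNReal.ofReal_mul (by positivity),
    ← ENNReal.ofReal_add (by positivity) (by positivity)]
  refine ENNReal.ofReal_le_ofReal ?_
  rw [div_mul_eq_mul_div, ← mul_le_mul_iff_left₀ hNpos,
    add_mul, div_mul_cancel₀ _ hNpos.ne', ← sq, hN2]
  -- Pair the decomposition `v = x + y` with `v` itself: Cauchy–Schwarz for `x`, and the duality of
  -- the sum and maximum norms for `y`.
  have hx : v 0 * x 0 + v 1 * x 1 ≤ ‖WithLp.toLp 2 x‖ * N := by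
    refine le_of_sq_le_sq ?_ (by positivity)
    rw [mul_pow, hN2, norm_toLp_sq]
    nlinarith [sq_nonneg (v 0 * x 1 - v 1 * x 0)]
  have hy : v 0 * y 0 + v 1 * y 1 ≤ (|v 0| + |v 1|) * ‖y‖ := by
    have h (i : Fin 2) : v i * y i ≤ |v i| * ‖y‖ := by
      refine (le_abs_self _).trans ?_
      rw [abs_mul]
      gcongr
      exact norm_le_pi_norm y i
    linarith [h 0, h 1]
  have h0 : v 0 = x 0 + y 0 := by rw [← hxy]; rfl
  have h1 : v 1 = x 1 + y 1 := by rw [← hxy]; rfl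
  calc v 0 ^ 2 + v 1 ^ 2 = v 0 * (x 0 + y 0) + v 1 * (x 1 + y 1) := by rw [← h0, ← h1]; ring
    _ ≤ _ := by linarith

/-- The constant equals `(1 + √2) / 2`. When `x ≤ y`, the difference of the two sides is `(√2 - 1) /
2` times `(y - (1 + √2) x) ^ 2`, so the constant is sharp for this inequality. -/
lemma max_mul_add_le (x y : ℝ) :
    max x y * (x + y) ≤ (4 + 3 * √2) / (4 + 2 * √2) * (x ^ 2 + y ^ 2) := by
  have h2 : √2 ^ 2 = 2 := Real.sq_sqrt zero_le_two
  have hs : 1 < √2 := by nlinarith [Real.sqrt_nonneg 2]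
  have hC : (4 + 3 * √2) / (4 + 2 * √2) = (1 + √2) / 2 := by
    rw [div_eq_div_iff (by positivity) (by positivity)]
    nlinarith
  rw [hC]
  rcases le_total x y with h | h
  · rw [max_eq_right h]
    nlinarith [mul_nonneg (sub_nonneg.2 hs.le) (sq_nonneg (y - (1 + √2) * x))]
  · rw [max_eq_left h]
    nlinarith [mul_nonneg (sub_nonneg.2 hs.le) (sq_nonneg (x - (1 + √2) * y))]

lemma norm_mul_add_le (v : Fin 2 → ℝ) :
    ‖v‖ * (|v 0| + |v 1|) ≤ (4 + 3 * √2) / (4 + 2 * √2) * ‖WithLp.toLp 2 v‖ ^ 2 := by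
  have hn : ‖v‖ ≤ max |v 0| |v 1| :=
    (pi_norm_le_iff_of_nonneg (by positivity)).2 fun i => by
      fin_cases i <;> simp
  have := max_mul_add_le |v 0| |v 1|
  rw [sq_abs, sq_abs, ← norm_toLp_sq] at this
  exact (mul_le_mul_of_nonneg_right hn (by positivity)).trans this

/-- A positive concave function on `(0, ∞)` is nondecreasing. -/
lemma monotoneOn_of_concaveOn_pos {φ : ℝ → ℝ} (hpos : ∀ t, 0 < t → 0 < φ t)
    (hφ : ConcaveOn ℝ (Ioi 0) φ) : MonotoneOn φ (Ioi 0) := by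
  intro s hs t ht hst
  rcases hst.eq_or_lt with rfl | hst
  · rfl
  by_contra! hlt
  simp only [mem_Ioi] at hs ht
  set m := (φ s - φ t) / (t - s) with hm
  have hmpos : 0 < m := div_pos (sub_pos.2 hlt) (sub_pos.2 hst)
  -- The line through the points of the graph over `s` and `t` vanishes at `z`, and concavity keeps
  -- `φ z` below it.
  set z := t + φ t / m with hz
  have hzt : t < z := lt_add_of_pos_right _ (div_pos (hpos t ht) hmpos)
  have := hφ.slope_anti_adjacent (mem_Ioi.2 hs) (mem_Ioi.2 (ht.trans hzt)) hst hzt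
  have hzpos := hpos z (ht.trans hzt)
  rw [div_le_iff₀ (sub_pos.2 hzt)] at this
  have h1 : (φ t - φ s) / (t - s) = -m := by rw [hm]; ring
  have h2 : m * (z - t) = φ t := by rw [hz]; field_simp; ring
  rw [h1] at this
  linarith

/-- For a positive concave `φ` on `(0, ∞)` the quotient `φ t / t` is nonincreasing. -/
lemma mul_le_mul_of_concaveOn_pos {φ : ℝ → ℝ} (hpos : ∀ t, 0 < t → 0 < φ t)
    (hφ : ConcaveOn ℝ (Ioi 0) φ) {s t : ℝ} (hs : 0 < s) (hst : s ≤ t) : s * φ t ≤ t * φ s := by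
  rcases hst.eq_or_lt with rfl | hst
  · rfl
  have ht := hs.trans hst
  -- Compare slopes over `r < s < t` and discard `φ r > 0`. As `φ` is only controlled on the open
  -- half-line, the claim follows by letting `r` tend to `0`.
  have key : ∀ r ∈ Ioo 0 s, (s - r) * φ t ≤ (t - r) * φ s := by
    rintro r ⟨hr, hrs⟩
    have := hφ.slope_anti_adjacent (mem_Ioi.2 hr) (mem_Ioi.2 ht) hrs hst
    rw [div_le_div_iff₀ (sub_pos.2 hst) (sub_pos.2 hrs)] at this
    nlinarith [mul_pos (sub_pos.2 hst) (hpos r hr)]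
  have hc1 : Tendsto (fun r => (s - r) * φ t) (𝓝[>] 0) (𝓝 ((s - 0) * φ t)) :=
    Continuous.tendsto (by fun_prop) 0 |>.mono_left nhdsWithin_le_nhds
  have hc2 : Tendsto (fun r => (t - r) * φ s) (𝓝[>] 0) (𝓝 ((t - 0) * φ s)) :=
    Continuous.tendsto (by fun_prop) 0 |>.mono_left nhdsWithin_le_nhds
  simpa using le_of_tendsto_of_tendsto hc1 hc2
    (eventually_of_mem (Ioo_mem_nhdsGT hs) key)

lemma isKDivisibilityConstant_coupleX :
    IsKDivisibilityConstant coupleX ((4 + 3 * √2) / (4 + 2 * √2)).toNNReal := by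
  intro v φ hpos hconc hsum hK
  set C := (4 + 3 * √2) / (4 + 2 * √2) with hC
  have hC0 : 0 ≤ C := by positivity
  have hC1 : 1 ≤ C := by
    rw [hC, one_le_div (by positivity)]
    linarith [Real.sqrt_nonneg 2]
  by_cases hv : v = 0
  · have h0 : ∀ t, peetreK coupleX t 0 = 0 := fun t =>
      le_antisymm ((peetreK_coupleX_le_left t 0).trans (by simp)) zero_le
    exact ⟨fun _ => 0, by simp [hv, h0], fun n t _ => by simp [h0]⟩
  set N := ‖WithLp.toLp 2 v‖ with hN
  have hNpos : 0 < N := norm_pos_iff.2 (by simpa using hv)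
  have hN2 : N ^ 2 = v 0 ^ 2 + v 1 ^ 2 := norm_toLp_sq v
  set τ := (|v 0| + |v 1|) / N with hτ
  have hτ1 : 1 ≤ τ := by
    rw [hτ, one_le_div hNpos]
    refine le_of_sq_le_sq ?_ (by positivity)
    nlinarith [sq_abs (v 0), sq_abs (v 1), mul_nonneg (abs_nonneg (v 0)) (abs_nonneg (v 1))]
  have hτ0 : 0 < τ := one_pos.trans_le hτ1
  have hφ : ∀ n, 0 < φ n τ := fun n => hpos n τ hτ0
  -- Summability is only given at `1`; since `τ ≥ 1`, it transfers through `φ n τ ≤ τ * φ n 1`.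
  have hsτ : Summable fun n => φ n τ := by
    refine Summable.of_nonneg_of_le (fun n => (hφ n).le) (fun n => ?_) (hsum.mul_left τ)
    simpa using mul_le_mul_of_concaveOn_pos (hpos n) (hconc n) one_pos hτ1
  set S := ∑' n, φ n τ with hS
  have hNS : N ≤ S := by
    have := (norm_le_peetreK_coupleX hv).trans (hK τ hτ0)
    rw [← ENNReal.ofReal_tsum_of_nonneg (fun n => (hφ n).le) hsτ] at this
    exact (ENNReal.ofReal_le_ofReal_iff (tsum_nonneg fun n => (hφ n).le)).1 this
  have hSpos : 0 < S := hNpos.trans_le hNS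
  refine ⟨fun n => (φ n τ / S) • v, ?_, fun n t ht => ?_⟩
  · have hlim : Tendsto (fun M => 1 - ∑ n ∈ Finset.range M, φ n τ / S) atTop (𝓝 0) := by
      have := (hsτ.hasSum.div_const S).tendsto_sum_nat
      rw [← hS, div_self hSpos.ne'] at this
      simpa using this.const_sub 1
    have hlim' : Tendsto (fun M => ENNReal.ofReal
        (|1 - ∑ n ∈ Finset.range M, φ n τ / S| * min N (1 * ‖v‖))) atTop (𝓝 0) := by
      have := ENNReal.tendsto_ofReal (hlim.abs.mul_const (min N (1 * ‖v‖)))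
      simpa using this
    refine tendsto_of_tendsto_of_tendsto_of_le_of_le tendsto_const_nhds hlim'
      (fun _ => zero_le) fun M => ?_
    have : v - ∑ n ∈ Finset.range M, (φ n τ / S) • v =
        (1 - ∑ n ∈ Finset.range M, φ n τ / S) • v := by
      rw [sub_smul, one_smul, Finset.sum_smul]
    simp only [this]
    exact peetreK_coupleX_smul_le 1 v
  · refine (peetreK_coupleX_smul_le t v).trans ?_
    change _ ≤ ENNReal.ofReal C * _
    rw [← ENNReal.ofReal_mul hC0]
    refine ENNReal.ofReal_le_ofReal ?_
    rw [abs_of_pos (div_pos (hφ n) hSpos)]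
    have hle : φ n τ / S ≤ φ n τ / N := div_le_div_of_nonneg_left (hφ n).le hNpos hNS
    refine (mul_le_mul_of_nonneg_right hle (by positivity)).trans ?_
    have ht0 := hpos n t ht
    -- Above `τ` monotonicity of `φ n` costs nothing. Below `τ`, passing from `φ n τ` to `φ n t`
    -- costs `τ / t`, which the bound `t * ‖v‖` on the `K`-functional turns into `τ * ‖v‖ / N ≤ C`.
    rcases le_total τ t with h | h
    · calc φ n τ / N * min N (t * ‖v‖) ≤ φ n τ / N * N := by
            have := hφ n
            gcongr
            exact min_le_left _ _
        _ = φ n τ := div_mul_cancel₀ _ hNpos.ne'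
        _ ≤ φ n t := monotoneOn_of_concaveOn_pos (hpos n) (hconc n) hτ0 ht h
        _ ≤ C * φ n t := le_mul_of_one_le_left ht0.le hC1
    · have hm := mul_le_mul_of_concaveOn_pos (hpos n) (hconc n) ht h
      have hb : τ * ‖v‖ ≤ C * N := by
        have := norm_mul_add_le v
        rw [hτ, div_mul_eq_mul_div, div_le_iff₀ hNpos]
        linarith
      calc φ n τ / N * min N (t * ‖v‖) ≤ φ n τ / N * (t * ‖v‖) := by
            have := hφ n
            gcongr
            exact min_le_right _ _
        _ = t * φ n τ * (‖v‖ / N) := by ring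
        _ ≤ τ * φ n t * (‖v‖ / N) := by gcongr
        _ = τ * ‖v‖ * (φ n t / N) := by ring
        _ ≤ C * N * (φ n t / N) := by gcongr
        _ = C * φ n t := by field_simp

lemma kDivisibility_coupleX_le :
    kDivisibility coupleX ≤ ENNReal.ofReal ((4 + 3 * √2) / (4 + 2 * √2)) :=
  iInf₂_le _ isKDivisibilityConstant_coupleX

end Divisibility

/-! ### The weight -/

/-- The distance of `(a, 1)` from `(t, t)`. -/
def errFun (a t : ℝ) : ℝ := √((t - a) ^ 2 + (t - 1) ^ 2)

/-- The second coordinate of the corner `(1, √(w ^ 2 - 1))` of the intersection of the unit ball of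
`ℓ₂^∞` with the ball of radius `w` of `ℓ₂²`. -/
def corner (a t : ℝ) : ℝ := √(weight a t ^ 2 - 1)

section Weight

variable {a : ℝ}

lemma errFun_arg_pos (ha : 1 < a) (t : ℝ) : 0 < (t - a) ^ 2 + (t - 1) ^ 2 := by
  nlinarith [sq_nonneg (t - a + (t - 1)), sq_pos_of_pos (sub_pos.2 ha)]

lemma errFun_pos (ha : 1 < a) (t : ℝ) : 0 < errFun a t := Real.sqrt_pos.2 (errFun_arg_pos ha t)

lemma errFun_sq (ha : 1 < a) (t : ℝ) : errFun a t ^ 2 = (t - a) ^ 2 + (t - 1) ^ 2 :=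
  Real.sq_sqrt (errFun_arg_pos ha t).le

lemma errFun_one (ha : 1 < a) : errFun a 1 = a - 1 := by
  rw [errFun, sub_self, zero_pow two_ne_zero, add_zero, Real.sqrt_sq_eq_abs, abs_sub_comm,
    abs_of_pos (sub_pos.2 ha)]

lemma continuous_errFun : Continuous (errFun a) := by
  unfold errFun; fun_prop

lemma weight_of_le_one (ha : 1 < a) {t : ℝ} (ht : t ≤ 1) :
    weight a t = (a + 1 - 2 * t) / errFun a t := by
  rcases ht.lt_or_eq with h | rfl
  · simp [weight, h, errFun]
  · rw [errFun_one ha, weight, if_neg (lt_irrefl _), eq_div_iff (sub_pos.2 ha).ne']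
    ring

lemma weight_of_one_le {t : ℝ} (ht : 1 ≤ t) : weight a t = 1 := if_neg ht.not_gt

/-- The two branches of the weight agree at `1`, so a single formula yields continuity, positivity
and the bound `√2`. -/
lemma weight_eq_min (ha : 1 < a) (t : ℝ) :
    weight a t = (a + 1 - 2 * min t 1) / errFun a (min t 1) := by
  rcases le_total t 1 with h | h
  · rw [min_eq_left h, weight_of_le_one ha h]
  · rw [min_eq_right h, weight_of_one_le h, ← weight_of_le_one ha le_rfl, weight_of_one_le le_rfl]

lemma continuous_weight (ha : 1 < a) : Continuous (weight a) := by
  rw [funext (weight_eq_min ha)]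
  refine Continuous.div (by fun_prop) (continuous_errFun.comp (by fun_prop)) fun t => ?_
  exact (errFun_pos ha _).ne'

lemma weight_sq_of_le_one (ha : 1 < a) {t : ℝ} (ht : t ≤ 1) :
    weight a t ^ 2 = 1 + 2 * ((a - t) * (1 - t)) / ((t - a) ^ 2 + (t - 1) ^ 2) := by
  rw [weight_of_le_one ha ht, div_pow, errFun_sq ha]
  have := (errFun_arg_pos ha t).ne'
  field_simp
  ring

lemma weight_pos (ha : 1 < a) (t : ℝ) : 0 < weight a t := by
  rw [weight_eq_min ha]
  exact div_pos (by linarith [min_le_right t 1]) (errFun_pos ha _)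

/-- With `x = a - t` and `y = 1 - t`, `w² - 1 = 2xy / (x² + y²)` is an increasing function of `y / x
∈ [0, 1)`, and this ratio decreases in `t`. After cross-multiplication the difference factors as the
product of the quantities in `h1` and `h2`, up to a constant. -/
lemma weight_strictAntiOn (ha : 1 < a) : StrictAntiOn (weight a) (Iic 1) := by
  intro s hs t ht hst
  simp only [mem_Iic] at hs ht
  refine lt_of_pow_lt_pow_left₀ 2 (weight_pos ha s).le ?_
  rw [weight_sq_of_le_one ha hs, weight_sq_of_le_one ha ht, add_lt_add_iff_left,
    div_lt_div_iff₀ (errFun_arg_pos ha t) (errFun_arg_pos ha s)]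
  have h1 : 0 < (a - 1) * (t - s) := mul_pos (sub_pos.2 ha) (sub_pos.2 hst)
  have h2 : 0 < (a - s) * (a - t) - (1 - s) * (1 - t) := by nlinarith
  nlinarith [mul_pos h1 h2]

lemma weight_antitone (ha : 1 < a) : Antitone (weight a) := by
  intro s t hst
  rcases le_total t 1 with h | h
  · exact (weight_strictAntiOn ha).antitoneOn (mem_Iic.2 (hst.trans h)) (mem_Iic.2 h) hst
  · rcases le_total s 1 with h' | h'
    · rw [weight_of_one_le h, ← weight_of_one_le (a := a) le_rfl]
      exact (weight_strictAntiOn ha).antitoneOn (mem_Iic.2 h') (mem_Iic.2 le_rfl) h'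
    · rw [weight_of_one_le h, weight_of_one_le h']

lemma weight_lt_weight (ha : 1 < a) {s t : ℝ} (hs : s < 1) (hst : s < t) :
    weight a t < weight a s := by
  rcases le_total t 1 with h | h
  · exact weight_strictAntiOn ha hs.le h hst
  · rw [weight_of_one_le h, ← weight_of_one_le (a := a) le_rfl]
    exact weight_strictAntiOn ha hs.le (mem_Iic.2 le_rfl) hs

lemma one_le_weight (ha : 1 < a) (t : ℝ) : 1 ≤ weight a t := by
  rcases le_total t 1 with h | h
  · exact (weight_of_one_le (a := a) le_rfl).symm.le.trans (weight_antitone ha h)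
  · rw [weight_of_one_le h]

lemma weight_sq_le_two (ha : 1 < a) (t : ℝ) : weight a t ^ 2 ≤ 2 := by
  rw [weight_eq_min ha, div_pow, errFun_sq ha, div_le_iff₀ (errFun_arg_pos ha _)]
  nlinarith [sq_nonneg (a - 1)]

lemma continuous_corner (ha : 1 < a) : Continuous (corner a) :=
  (((continuous_weight ha).pow 2).sub continuous_const).sqrt

lemma corner_nonneg (t : ℝ) : 0 ≤ corner a t := Real.sqrt_nonneg _

lemma corner_sq (ha : 1 < a) (t : ℝ) : corner a t ^ 2 = weight a t ^ 2 - 1 :=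
  Real.sq_sqrt (by nlinarith [one_le_weight ha t])

lemma corner_antitone (ha : 1 < a) : Antitone (corner a) := fun s t hst => by
  have := weight_antitone ha hst
  have := weight_pos ha t
  exact Real.sqrt_le_sqrt (by gcongr)

lemma corner_le_one (ha : 1 < a) (t : ℝ) : corner a t ≤ 1 := by
  nlinarith [corner_sq ha t, weight_sq_le_two ha t, corner_nonneg (a := a) t]

lemma corner_pos (ha : 1 < a) {t : ℝ} (ht : t < 1) : 0 < corner a t := by
  have := weight_lt_weight ha ht ht
  rw [weight_of_one_le le_rfl] at this
  exact Real.sqrt_pos.2 (by nlinarith)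

lemma corner_one : corner a 1 = 0 := by
  simp [corner, weight_of_one_le]

lemma corner_zero_sq (ha : 1 < a) : corner a 0 ^ 2 = 2 * a / (a ^ 2 + 1) := by
  rw [corner_sq ha, weight_sq_of_le_one ha zero_le_one]
  ring

/-- On `(-∞, 1]` the weight is minus the derivative of `errFun a`; on `[1, a]` it is `1` and
contributes `a - 1 = errFun a 1`. -/
lemma integral_weight (ha : 1 < a) {s : ℝ} (hs : s ≤ 1) : ∫ t in s..a, weight a t = errFun a s := by
  have hd : ∀ t, HasDerivAt (fun t => -errFun a t) ((a + 1 - 2 * t) / errFun a t) t := by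
    intro t
    have h1 : HasDerivAt (fun t : ℝ => (t - a) ^ 2 + (t - 1) ^ 2) (2 * (t - a) + 2 * (t - 1)) t := by
      have := (((hasDerivAt_id t).sub_const a).pow 2).add (((hasDerivAt_id t).sub_const 1).pow 2)
      refine this.congr_deriv ?_
      simp
    have h2 := (h1.sqrt (errFun_arg_pos ha t).ne').neg
    refine h2.congr_deriv ?_
    change -((2 * (t - a) + 2 * (t - 1)) / (2 * errFun a t)) = _
    have := (errFun_pos ha t).ne'
    field_simp
    ring
  have hi := fun p q : ℝ => (continuous_weight ha).intervalIntegrable (μ := volume) p q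
  rw [← intervalIntegral.integral_add_adjacent_intervals (hi s 1) (hi 1 a)]
  have h1 : ∫ t in s..1, weight a t = ∫ t in s..1, (a + 1 - 2 * t) / errFun a t := by
    refine intervalIntegral.integral_congr fun t ht => ?_
    rw [uIcc_of_le hs] at ht
    exact weight_of_le_one ha ht.2
  have h2 : ∫ t in (1 : ℝ)..a, weight a t = ∫ _ in (1 : ℝ)..a, (1 : ℝ) := by
    refine intervalIntegral.integral_congr fun t ht => ?_
    rw [uIcc_of_le ha.le] at ht
    exact weight_of_one_le ht.1
  rw [h1, h2, intervalIntegral.integral_eq_sub_of_hasDerivAt (fun t _ => hd t), errFun_one ha]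
  · simp only [intervalIntegral.integral_const, smul_eq_mul]
    ring
  · refine (Continuous.div (by fun_prop) continuous_errFun fun t => ?_).intervalIntegrable _ _
    exact (errFun_pos ha t).ne'

/-- The equation that determines the point at which the minimal operator leaves the corner. -/
lemma exists_switch (ha : 1 < a) :
    ∃ ξ ∈ Ioo (0 : ℝ) 1, ξ + errFun a ξ / weight a ξ =
      a * ((∫ t in (0 : ℝ)..ξ, corner a t) + errFun a ξ * corner a ξ / weight a ξ) := by
  set F : ℝ → ℝ := fun ξ => ξ + errFun a ξ / weight a ξ -
    a * ((∫ t in (0 : ℝ)..ξ, corner a t) + errFun a ξ * corner a ξ / weight a ξ) with hF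
  have hw : ∀ t, weight a t ≠ 0 := fun t => (weight_pos ha t).ne'
  have hFc : Continuous F := by
    have h1 := continuous_weight ha
    have h2 := continuous_corner ha
    have h3 := continuous_errFun (a := a)
    have h4 : Continuous fun ξ => ∫ t in (0 : ℝ)..ξ, corner a t :=
      intervalIntegral.continuous_primitive (fun p q => h2.intervalIntegrable p q) 0
    exact (continuous_id.add (h3.div h1 hw)).sub
      (continuous_const.mul (h4.add ((h3.mul h2).div h1 hw)))
  have hq0 := corner_nonneg (a := a) 0
  have hq := corner_zero_sq ha
  have hpos : 0 < a ^ 2 + 1 := by positivity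
  -- At `ξ = 0` all vectors point in the direction `(1, corner a 0)`, which is steeper than `(a, 1)`
  -- because `2 a³ > a² + 1`.
  have h0 : F 0 < 0 := by
    have : 1 < a * corner a 0 := by
      have : 1 < a ^ 2 * corner a 0 ^ 2 := by
        rw [hq, ← mul_div_assoc, lt_div_iff₀ hpos]
        nlinarith [mul_pos (sub_pos.2 ha) (sub_pos.2 ha), mul_pos (zero_lt_one.trans ha) hpos,
          pow_pos (sub_pos.2 ha) 3]
      have h' : 0 ≤ a * corner a 0 := mul_nonneg (by linarith) hq0
      nlinarith
    have hE : 0 < errFun a 0 / weight a 0 := div_pos (errFun_pos ha 0) (weight_pos ha 0)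
    have : F 0 = errFun a 0 / weight a 0 * (1 - a * corner a 0) := by
      simp only [hF, intervalIntegral.integral_same]
      ring
    rw [this]
    exact mul_neg_of_pos_of_neg hE (by linarith)
  -- At `ξ = 1` the arc part is horizontal since `corner a 1 = 0`, and the corner part contributes
  -- less than `1` to the second coordinate.
  have h1 : 0 < F 1 := by
    have hlt : corner a 0 < 1 := by
      have : corner a 0 ^ 2 < 1 := by
        rw [hq, div_lt_one hpos]
        nlinarith [mul_pos (sub_pos.2 ha) (sub_pos.2 ha)]
      nlinarith
    have hint : ∫ t in (0 : ℝ)..1, corner a t ≤ corner a 0 := by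
      have := intervalIntegral.integral_mono_on (μ := volume) zero_le_one
        ((continuous_corner ha).intervalIntegrable 0 1)
        (intervalIntegrable_const (c := corner a 0)) fun t ht => corner_antitone ha ht.1
      simpa using this
    have : F 1 = a * (1 - ∫ t in (0 : ℝ)..1, corner a t) := by
      simp only [hF, errFun_one ha, corner_one, weight_of_one_le le_rfl]
      ring
    rw [this]
    exact mul_pos (by linarith) (by linarith)
  obtain ⟨ξ, hξ, h⟩ := intermediate_value_Ioo zero_le_one hFc.continuousOn ⟨h0, h1⟩
  exact ⟨ξ, hξ, sub_eq_zero.1 h⟩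

end Weight

/-! ### Operators from `P` to `X` -/

section Operators

variable {V W : Type*} [AddCommGroup V] [Module ℝ V] [AddCommGroup W] [Module ℝ W]

/-- The infimum is attained: let admissible constants decrease to it, using that multiplication by a
finite value is continuous. -/
lemma le_coupleOpNorm_mul {A : Couple V} {B : Couple W} {T : V →ₗ[ℝ] W}
    (hT : coupleOpNorm A B T < ∞) {j : Fin 2} {v : V} (hv : A j v < ∞) :
    B j (T v) ≤ coupleOpNorm A B T * A j v := by
  have hlim : Tendsto (fun c => c * A j v) (𝓝[>] coupleOpNorm A B T)
      (𝓝 (coupleOpNorm A B T * A j v)) :=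
    (ENNReal.Tendsto.mul_const tendsto_id (Or.inr hv.ne)).mono_left nhdsWithin_le_nhds
  have : (𝓝[>] coupleOpNorm A B T).NeBot := nhdsGT_neBot_of_exists_gt ⟨∞, hT⟩
  refine ge_of_tendsto hlim (eventually_mem_nhdsWithin.mono fun c hc => ?_)
  obtain ⟨c', hc', hlt⟩ := sInf_lt_iff.1 (mem_Ioi.1 hc)
  exact (hc' j v hv).trans (by gcongr)

variable {a : ℝ}

lemma integrable_abs_mul_weight (ha : 1 < a) (h : Lp ℝ 1 (leb a)) :
    Integrable (fun t => |h t| * weight a t) (leb a) := by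
  refine (L1.integrable_coeFn h).abs.mul_bdd (c := 2)
    (continuous_weight ha).aestronglyMeasurable (Eventually.of_forall fun t => ?_)
  rw [Real.norm_eq_abs, abs_of_pos (weight_pos ha t)]
  nlinarith [weight_sq_le_two ha t, one_le_weight ha t]

lemma coupleP_zero (ha : 1 < a) (h : Lp ℝ 1 (leb a)) :
    coupleP a 0 h = ENNReal.ofReal (∫ t, |h t| * weight a t ∂(leb a)) := by
  rw [ofReal_integral_eq_lintegral_ofReal (integrable_abs_mul_weight ha h)
    (Eventually.of_forall fun t => mul_nonneg (abs_nonneg _) (weight_pos ha t).le)]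
  refine lintegral_congr fun t => ?_
  rw [ENNReal.ofReal_mul (abs_nonneg _), ← Real.norm_eq_abs, ofReal_norm]

lemma coupleP_one (h : Lp ℝ 1 (leb a)) :
    coupleP a 1 h = ENNReal.ofReal (∫ t, |h t| ∂(leb a)) := by
  rw [ofReal_integral_eq_lintegral_ofReal (L1.integrable_coeFn h).abs
    (Eventually.of_forall fun t => abs_nonneg _)]
  refine lintegral_congr fun t => ?_
  rw [← Real.norm_eq_abs, ofReal_norm]

/-- Both norms of `P` are finite on all of `L¹(0, a)`, so the condition `A j v < ∞` disappears and
everything becomes a real inequality. -/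
lemma coupleOpNorm_le_iff (ha : 1 < a) {T : Lp ℝ 1 (leb a) →ₗ[ℝ] (Fin 2 → ℝ)} {c : ℝ}
    (hc : 0 ≤ c) :
    coupleOpNorm (coupleP a) coupleX T ≤ ENNReal.ofReal c ↔
      ∀ h, ‖WithLp.toLp 2 (T h)‖ ≤ c * ∫ t, |h t| * weight a t ∂(leb a) ∧
        ‖T h‖ ≤ c * ∫ t, |h t| ∂(leb a) := by
  have hw : ∀ h : Lp ℝ 1 (leb a), 0 ≤ ∫ t, |h t| * weight a t ∂(leb a) := fun h =>
    integral_nonneg fun t => mul_nonneg (abs_nonneg _) (weight_pos ha t).le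
  have h1 : ∀ h : Lp ℝ 1 (leb a), 0 ≤ ∫ t, |h t| ∂(leb a) := fun h =>
    integral_nonneg fun t => abs_nonneg _
  have key : (∀ h, ‖WithLp.toLp 2 (T h)‖ ≤ c * ∫ t, |h t| * weight a t ∂(leb a) ∧
        ‖T h‖ ≤ c * ∫ t, |h t| ∂(leb a)) ↔
      ∀ j h, coupleX j (T h) ≤ ENNReal.ofReal c * coupleP a j h := by
    rw [Fin.forall_fin_two, ← forall_and]
    refine forall_congr' fun h => ?_
    rw [coupleP_zero ha, coupleP_one, ← ENNReal.ofReal_mul hc, ← ENNReal.ofReal_mul hc]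
    simp only [coupleX, Matrix.cons_val_zero, Matrix.cons_val_one]
    rw [← ofReal_norm, ← ofReal_norm, ENNReal.ofReal_le_ofReal_iff (mul_nonneg hc (hw h)),
      ENNReal.ofReal_le_ofReal_iff (mul_nonneg hc (h1 h))]
  rw [key]
  constructor
  · intro hT j h
    have hfin : coupleP a j h < ∞ := by
      fin_cases j
      · exact (coupleP_zero ha h).trans_lt ENNReal.ofReal_lt_top
      · exact (coupleP_one h).trans_lt ENNReal.ofReal_lt_top
    refine (le_coupleOpNorm_mul (hT.trans_lt ENNReal.ofReal_lt_top) hfin).trans ?_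
    gcongr
  · exact fun hT => sInf_le fun j h _ => hT j h

lemma integrable_mul_of_memLp_top {g : ℝ → ℝ} (hg : MemLp g ∞ (leb a)) (h : Lp ℝ 1 (leb a)) :
    Integrable (fun t => h t * g t) (leb a) :=
  (L1.integrable_coeFn h).mul_of_top_left hg

/-- The operator `h ↦ (∫ h g₀, ∫ h g₁)`. -/
def pairOp {g₀ g₁ : ℝ → ℝ} (hg₀ : MemLp g₀ ∞ (leb a)) (hg₁ : MemLp g₁ ∞ (leb a)) :
    Lp ℝ 1 (leb a) →ₗ[ℝ] (Fin 2 → ℝ) where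
  toFun h := ![∫ t, h t * g₀ t ∂(leb a), ∫ t, h t * g₁ t ∂(leb a)]
  map_add' h k := by
    have key {g : ℝ → ℝ} (hg : MemLp g ∞ (leb a)) : ∫ t, (h + k) t * g t ∂(leb a) =
        ∫ t, h t * g t ∂(leb a) + ∫ t, k t * g t ∂(leb a) := by
      rw [← integral_add (integrable_mul_of_memLp_top hg h) (integrable_mul_of_memLp_top hg k)]
      refine integral_congr_ae ?_
      filter_upwards [Lp.coeFn_add h k] with t ht
      rw [ht, Pi.add_apply, add_mul]
    rw [key hg₀, key hg₁]
    simp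
  map_smul' r h := by
    have key (g : ℝ → ℝ) : ∫ t, (r • h) t * g t ∂(leb a) = r * ∫ t, h t * g t ∂(leb a) := by
      rw [← integral_const_mul]
      refine integral_congr_ae ?_
      filter_upwards [Lp.coeFn_smul r h] with t ht
      rw [ht, Pi.smul_apply, smul_eq_mul, mul_assoc]
    rw [key, key]
    simp

lemma coupleOpNorm_pairOp_le (ha : 1 < a) {g₀ g₁ : ℝ → ℝ} (hg₀ : MemLp g₀ ∞ (leb a))
    (hg₁ : MemLp g₁ ∞ (leb a)) {c : ℝ} (hc : 0 ≤ c) (h₀ : ∀ t, |g₀ t| ≤ c) (h₁ : ∀ t, |g₁ t| ≤ c)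
    (h₂ : ∀ t, g₀ t ^ 2 + g₁ t ^ 2 ≤ (c * weight a t) ^ 2) :
    coupleOpNorm (coupleP a) coupleX (pairOp hg₀ hg₁) ≤ ENNReal.ofReal c := by
  rw [coupleOpNorm_le_iff ha hc]
  intro h
  have hi₀ := integrable_mul_of_memLp_top hg₀ h
  have hi₁ := integrable_mul_of_memLp_top hg₁ h
  have hab : 0 ≤ ∫ t, |h t| ∂(leb a) := integral_nonneg fun t => abs_nonneg _
  constructor
  · set x := pairOp hg₀ hg₁ h with hx
    have hx0 : x 0 = ∫ t, h t * g₀ t ∂(leb a) := rfl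
    have hx1 : x 1 = ∫ t, h t * g₁ t ∂(leb a) := rfl
    set N := ‖WithLp.toLp 2 x‖ with hN
    have hN2 : N ^ 2 = x 0 ^ 2 + x 1 ^ 2 := by
      rw [hN, EuclideanSpace.norm_sq_eq]; simp
    have hN0 : 0 ≤ N := norm_nonneg _
    -- Pairing the image `x` with itself moves the Euclidean norm under the integral, where
    -- Cauchy–Schwarz applies pointwise.
    have hle : N ^ 2 ≤ N * (c * ∫ t, |h t| * weight a t ∂(leb a)) := by
      have e1 : N ^ 2 = ∫ t, (x 0 * (h t * g₀ t) + x 1 * (h t * g₁ t)) ∂(leb a) := by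
        rw [integral_add (hi₀.const_mul _) (hi₁.const_mul _), integral_const_mul,
          integral_const_mul, ← hx0, ← hx1, hN2]
        ring
      rw [e1, ← mul_assoc, ← integral_const_mul]
      refine integral_mono ((hi₀.const_mul _).add (hi₁.const_mul _))
        ((integrable_abs_mul_weight ha h).const_mul _) fun t => ?_
      have h3 : |x 0 * g₀ t + x 1 * g₁ t| ≤ N * (c * weight a t) := by
        refine abs_le_of_sq_le_sq ?_ (mul_nonneg hN0 (mul_nonneg hc (weight_pos ha t).le))
        have := h₂ t
        rw [mul_pow, hN2]
        nlinarith [sq_nonneg (x 0 * g₁ t - x 1 * g₀ t),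
          mul_le_mul_of_nonneg_left this (add_nonneg (sq_nonneg (x 0)) (sq_nonneg (x 1)))]
      calc x 0 * (h t * g₀ t) + x 1 * (h t * g₁ t) = h t * (x 0 * g₀ t + x 1 * g₁ t) := by ring
        _ ≤ |h t| * |x 0 * g₀ t + x 1 * g₁ t| := by rw [← abs_mul]; exact le_abs_self _
        _ ≤ |h t| * (N * (c * weight a t)) := by gcongr
        _ = N * c * (|h t| * weight a t) := by ring
    rcases hN0.eq_or_lt with h0 | h0
    · rw [← h0]
      exact mul_nonneg hc
        (integral_nonneg fun t => mul_nonneg (abs_nonneg _) (weight_pos ha t).le)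
    · exact le_of_mul_le_mul_left (by rwa [← sq]) h0
  · have key {g : ℝ → ℝ} (hg : ∀ t, |g t| ≤ c) (hi : Integrable (fun t => h t * g t) (leb a)) :
        ‖∫ t, h t * g t ∂(leb a)‖ ≤ c * ∫ t, |h t| ∂(leb a) := by
      refine (norm_integral_le_integral_norm _).trans ?_
      rw [← integral_const_mul]
      refine integral_mono hi.norm ((L1.integrable_coeFn h).abs.const_mul c) fun t => ?_
      simp only [norm_mul, Real.norm_eq_abs]
      rw [mul_comm]
      gcongr
      exact hg t
    refine (pi_norm_le_iff_of_nonneg (mul_nonneg hc hab)).2 (Fin.forall_fin_two.2 ⟨?_, ?_⟩)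
    · exact key h₀ hi₀
    · exact key h₁ hi₁

/-- The indicator function of `S` as an element of `L¹(0, a)`. -/
def chi (a : ℝ) {S : Set ℝ} (hS : MeasurableSet S) : Lp ℝ 1 (leb a) :=
  indicatorConstLp 1 hS (measure_ne_top _ _) 1

lemma integral_chi_mul {S : Set ℝ} (hS : MeasurableSet S) (g : ℝ → ℝ) :
    ∫ t, chi a hS t * g t ∂(leb a) = ∫ t in S, g t ∂(leb a) := by
  rw [← integral_indicator hS]
  refine integral_congr_ae ?_
  filter_upwards [indicatorConstLp_coeFn (p := 1) (hs := hS) (hμs := measure_ne_top (leb a) S)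
    (c := (1 : ℝ))] with t ht
  rw [chi, ht]
  by_cases h : t ∈ S <;> simp [h]

lemma abs_chi_ae {S : Set ℝ} (hS : MeasurableSet S) :
    (fun t => |chi a hS t|) =ᵐ[leb a] chi a hS := by
  filter_upwards [indicatorConstLp_coeFn (p := 1) (hs := hS) (hμs := measure_ne_top (leb a) S)
    (c := (1 : ℝ))] with t ht
  rw [chi, ht]
  by_cases h : t ∈ S <;> simp [h]

/-- Indicators are the only test functions that the lower bound and the uniqueness proof need. -/
lemma norm_apply_chi_le (ha : 1 < a) {T : Lp ℝ 1 (leb a) →ₗ[ℝ] (Fin 2 → ℝ)} {c : ℝ}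
    (hc : 0 ≤ c) (hT : coupleOpNorm (coupleP a) coupleX T ≤ ENNReal.ofReal c)
    {S : Set ℝ} (hS : MeasurableSet S) :
    T (chi a hS) 0 ^ 2 + T (chi a hS) 1 ^ 2 ≤ (c * ∫ t in S, weight a t ∂(leb a)) ^ 2 ∧
      ∀ i, |T (chi a hS) i| ≤ c * ∫ _ in S, (1 : ℝ) ∂(leb a) := by
  obtain ⟨h2, h1⟩ := (coupleOpNorm_le_iff ha hc).1 hT (chi a hS)
  constructor
  · have e : ∫ t, |chi a hS t| * weight a t ∂(leb a) = ∫ t in S, weight a t ∂(leb a) := by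
      rw [← integral_chi_mul hS]
      refine integral_congr_ae ?_
      filter_upwards [abs_chi_ae (a := a) hS] with t ht
      rw [ht]
    rw [e] at h2
    have := pow_le_pow_left₀ (norm_nonneg _) h2 2
    rw [EuclideanSpace.norm_sq_eq] at this
    simpa using this
  · have e : ∫ t, |chi a hS t| ∂(leb a) = ∫ _ in S, (1 : ℝ) ∂(leb a) := by
      rw [← integral_chi_mul hS]
      refine integral_congr_ae ?_
      filter_upwards [abs_chi_ae (a := a) hS] with t ht
      rw [ht, mul_one]
    rw [e] at h1
    exact fun i => (norm_le_pi_norm _ i).trans h1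

lemma setIntegral_leb {s z : ℝ} (hs : 0 ≤ s) (hsz : s ≤ z) (hz : z ≤ a) (g : ℝ → ℝ) :
    ∫ t in Ioc s z, g t ∂(leb a) = ∫ t in s..z, g t := by
  rw [leb, Measure.restrict_congr_set Ioo_ae_eq_Ioc,
    Measure.restrict_restrict_of_subset (Ioc_subset_Ioc hs hz),
    intervalIntegral.integral_of_le hsz]

lemma chi_add_chi {r s z : ℝ} (hrs : r ≤ s) (hsz : s ≤ z) :
    chi a (measurableSet_Ioc (a := r) (b := z)) =
      chi a (measurableSet_Ioc (a := r) (b := s)) +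
        chi a (measurableSet_Ioc (a := s) (b := z)) := by
  have h := indicatorConstLp_disjoint_union (p := 1) (μ := leb a)
    (measurableSet_Ioc (a := r) (b := s)) (measurableSet_Ioc (a := s) (b := z))
    (measure_ne_top _ _) (measure_ne_top _ _) (Ioc_disjoint_Ioc_of_le le_rfl) (1 : ℝ)
  simp only [Ioc_union_Ioc_eq_Ioc hrs hsz] at h
  exact h

lemma chi_Ioc_eq_const :
    chi a (measurableSet_Ioc (a := 0) (b := a)) = Lp.const 1 (leb a) (1 : ℝ) := by
  refine Lp.ext ?_
  filter_upwards [indicatorConstLp_coeFn (p := 1) (hs := measurableSet_Ioc (a := 0) (b := a))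
    (hμs := measure_ne_top (leb a) _) (c := (1 : ℝ)), Lp.coeFn_const (p := 1) (μ := leb a) (1 : ℝ),
    ae_restrict_mem measurableSet_Ioo] with t h1 h2 ht
  rw [chi, h1, h2, indicator_of_mem (Ioo_subset_Ioc_self ht), Function.const_apply]

end Operators

/-! ### The minimal operators -/

section Optimal

/-- The support function of `{x | ‖x‖_∞ ≤ m, ‖x‖₂ ≤ m W}` in a direction `(1, p)` below the corner
`m (1, q)`. -/
lemma add_mul_le_of_norm_le {x y m W p q : ℝ} (hp : 0 ≤ p) (hpq : p ≤ q) (hm : 0 ≤ m)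
    (hW : 0 < W) (hq : q ^ 2 = W ^ 2 - 1) (hx : x ≤ m) (hxy : x ^ 2 + y ^ 2 ≤ (m * W) ^ 2) :
    x + p * y ≤ m * (1 + p * q) := by
  rcases hp.eq_or_lt with rfl | hp
  · simpa using hx
  have hq0 : 0 < q := hp.trans_le hpq
  have h1 : x + q * y ≤ m * W ^ 2 := by
    refine le_of_sq_le_sq ?_ (by positivity)
    nlinarith [sq_nonneg (q * x - y), mul_le_mul_of_nonneg_right hxy (sq_nonneg W)]
  rw [show W ^ 2 = q ^ 2 + 1 by linarith] at h1
  -- `(1, p)` is the convex combination of `(1, 0)` and `(1, q)` with weights `1 - p / q` and `p /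
  -- q`.
  refine le_of_mul_le_mul_left ?_ hq0
  linarith [mul_le_mul_of_nonneg_left h1 hp.le,
    mul_le_mul_of_nonneg_left hx (sub_nonneg.2 hpq)]

/-- Since `0 < p < q`, both constraints enter the bound with positive weight, so equality makes both
of them tight. -/
lemma eq_corner_of_add_mul_eq {x y m W p q : ℝ} (hp : 0 < p) (hpq : p < q) (hm : 0 ≤ m)
    (hW : 0 < W) (hq : q ^ 2 = W ^ 2 - 1) (hx : x ≤ m) (hxy : x ^ 2 + y ^ 2 ≤ (m * W) ^ 2)
    (h : x + p * y = m * (1 + p * q)) : x = m ∧ y = m * q := by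
  have hq0 : 0 < q := hp.trans hpq
  have h1 : x + q * y ≤ m * W ^ 2 := by
    refine (add_mul_le_of_norm_le hq0.le le_rfl hm hW hq hx hxy).trans_eq ?_
    rw [← sq, hq]
    ring
  rw [show W ^ 2 = q ^ 2 + 1 by linarith] at h1
  have h2 : q * (x + p * y) = q * (m * (1 + p * q)) := by rw [h]
  have hxm : x = m := by
    refine le_antisymm hx (sub_nonneg.1 (nonneg_of_mul_nonneg_right ?_ (sub_pos.2 hpq)))
    linarith [mul_le_mul_of_nonneg_left h1 hp.le]
  refine ⟨hxm, mul_left_cancel₀ hp.ne' ?_⟩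
  rw [hxm] at h
  linarith

/-- Cauchy–Schwarz against `(1, p)`, a vector of length `v`; the equality case is
`eq_mul_div_of_add_mul_eq`. -/
lemma add_mul_le_of_sq_le {x y R p v : ℝ} (hR : 0 ≤ R) (hv : 0 < v) (hp : p ^ 2 = v ^ 2 - 1)
    (hxy : x ^ 2 + y ^ 2 ≤ R ^ 2) : x + p * y ≤ R * v := by
  refine le_of_sq_le_sq ?_ (by positivity)
  nlinarith [sq_nonneg (p * x - y), mul_le_mul_of_nonneg_right hxy (sq_nonneg v)]

lemma eq_mul_div_of_add_mul_eq {x y R p v : ℝ} (hv : 0 < v) (hp : p ^ 2 = v ^ 2 - 1)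
    (hxy : x ^ 2 + y ^ 2 ≤ R ^ 2) (h : x + p * y = R * v) : x = R / v ∧ y = R * p / v := by
  have key : (v * x - R) ^ 2 + (v * y - R * p) ^ 2 ≤ 0 := by
    have h1 : (v * x - R) ^ 2 + (v * y - R * p) ^ 2 =
        v ^ 2 * (x ^ 2 + y ^ 2) - 2 * v * R * (x + p * y) + R ^ 2 * (1 + p ^ 2) := by ring
    rw [h1, h, hp]
    nlinarith [mul_le_mul_of_nonneg_left hxy (sq_nonneg v)]
  have hx : v * x - R = 0 := by nlinarith [sq_nonneg (v * x - R), sq_nonneg (v * y - R * p)]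
  have hy : v * y - R * p = 0 := by nlinarith [sq_nonneg (v * x - R), sq_nonneg (v * y - R * p)]
  exact ⟨by rw [eq_div_iff hv.ne']; linarith, by rw [eq_div_iff hv.ne']; linarith⟩

variable {a : ℝ}

/-- The first component of the minimal operator, up to the factor `c_a`. -/
def optFst (a ξ t : ℝ) : ℝ := if t ≤ ξ then 1 else weight a t / weight a ξ

/-- The second component of the minimal operator, up to the factor `c_a`. -/
def optSnd (a ξ t : ℝ) : ℝ :=
  if t ≤ ξ then corner a t else weight a t * corner a ξ / weight a ξ

lemma integral_ite (ha : 1 < a) {ξ : ℝ} (hξ : ξ ∈ Ioo (0 : ℝ) 1) {f g : ℝ → ℝ}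
    (hf : Continuous f) (hg : Continuous g) :
    ∫ t, (if t ≤ ξ then f t else g t) ∂(leb a) = (∫ t in 0..ξ, f t) + ∫ t in ξ..a, g t := by
  have hξa : ξ ≤ a := (hξ.2.trans ha).le
  have e : ∫ t, (if t ≤ ξ then f t else g t) ∂(leb a) =
      ∫ t in 0..a, if t ≤ ξ then f t else g t := by
    rw [intervalIntegral.integral_of_le (hξ.1.le.trans hξa), leb,
      Measure.restrict_congr_set Ioo_ae_eq_Ioc]
  have e1 : EqOn (fun t => if t ≤ ξ then f t else g t) f (uIoc 0 ξ) := fun t ht => by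
    rw [uIoc_of_le hξ.1.le] at ht
    exact if_pos ht.2
  have e2 : EqOn (fun t => if t ≤ ξ then f t else g t) g (uIoc ξ a) := fun t ht => by
    rw [uIoc_of_le hξa] at ht
    exact if_neg ht.1.not_ge
  rw [e, ← intervalIntegral.integral_add_adjacent_intervals
    ((hf.intervalIntegrable 0 ξ).congr e1.symm) ((hg.intervalIntegrable ξ a).congr e2.symm),
    intervalIntegral.integral_congr_ae (Eventually.of_forall fun t ht => e1 ht),
    intervalIntegral.integral_congr_ae (Eventually.of_forall fun t ht => e2 ht)]

lemma integral_optFst (ha : 1 < a) {ξ : ℝ} (hξ : ξ ∈ Ioo (0 : ℝ) 1) :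
    ∫ t, optFst a ξ t ∂(leb a) = ξ + errFun a ξ / weight a ξ := by
  refine (integral_ite ha hξ continuous_const ((continuous_weight ha).div_const _)).trans ?_
  rw [intervalIntegral.integral_div, integral_weight ha hξ.2.le]
  simp

lemma integral_optSnd (ha : 1 < a) {ξ : ℝ} (hξ : ξ ∈ Ioo (0 : ℝ) 1) :
    ∫ t, optSnd a ξ t ∂(leb a) =
      (∫ t in (0 : ℝ)..ξ, corner a t) + errFun a ξ * corner a ξ / weight a ξ := by
  refine (integral_ite ha hξ (continuous_corner ha)
    (((continuous_weight ha).mul_const _).div_const _)).trans ?_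
  rw [intervalIntegral.integral_div, intervalIntegral.integral_mul_const,
    integral_weight ha hξ.2.le]

lemma measurable_optFst (ha : 1 < a) (ξ : ℝ) : Measurable (optFst a ξ) :=
  Measurable.ite measurableSet_Iic measurable_const
    ((continuous_weight ha).div_const _).measurable

lemma measurable_optSnd (ha : 1 < a) (ξ : ℝ) : Measurable (optSnd a ξ) :=
  Measurable.ite measurableSet_Iic (continuous_corner ha).measurable
    (((continuous_weight ha).mul_const _).div_const _).measurable

lemma optFst_pos (ha : 1 < a) (ξ t : ℝ) : 0 < optFst a ξ t := by
  unfold optFst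
  split_ifs
  · exact one_pos
  · exact div_pos (weight_pos ha t) (weight_pos ha ξ)

lemma optSnd_nonneg (ha : 1 < a) (ξ t : ℝ) : 0 ≤ optSnd a ξ t := by
  unfold optSnd
  split_ifs
  · exact corner_nonneg t
  · exact div_nonneg (mul_nonneg (weight_pos ha t).le (corner_nonneg ξ)) (weight_pos ha ξ).le

lemma weight_div_weight_le_one (ha : 1 < a) {ξ t : ℝ} (h : ξ ≤ t) :
    weight a t / weight a ξ ≤ 1 :=
  (div_le_one (weight_pos ha ξ)).2 (weight_antitone ha h)

lemma optFst_le_one (ha : 1 < a) (ξ t : ℝ) : optFst a ξ t ≤ 1 := by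
  unfold optFst
  split_ifs with h
  · exact le_rfl
  · exact weight_div_weight_le_one ha (not_le.1 h).le

lemma optSnd_le_one (ha : 1 < a) (ξ t : ℝ) : optSnd a ξ t ≤ 1 := by
  unfold optSnd
  split_ifs with h
  · exact corner_le_one ha t
  · rw [mul_div_right_comm]
    exact mul_le_one₀ (weight_div_weight_le_one ha (not_le.1 h).le) (corner_nonneg ξ)
      (corner_le_one ha ξ)

lemma optFst_sq_add_optSnd_sq (ha : 1 < a) (ξ t : ℝ) :
    optFst a ξ t ^ 2 + optSnd a ξ t ^ 2 = weight a t ^ 2 := by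
  unfold optFst optSnd
  split_ifs
  · rw [corner_sq ha]; ring
  · rw [div_pow, div_pow, mul_pow, corner_sq ha]
    have := (weight_pos ha ξ).ne'
    field_simp
    ring

/-- The duality bound for operators that map the constant function `1` to `(a, 1)`. -/
lemma add_corner_le (ha : 1 < a) {ξ : ℝ} (hξ : ξ ∈ Ioo (0 : ℝ) 1)
    {T : Lp ℝ 1 (leb a) →ₗ[ℝ] (Fin 2 → ℝ)} {c : ℝ} (hc : 0 ≤ c)
    (hT : coupleOpNorm (coupleP a) coupleX T ≤ ENNReal.ofReal c)
    (hT1 : T (Lp.const 1 (leb a) (1 : ℝ)) = ![a, 1]) :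
    a + corner a ξ ≤
      c * (∫ t, optFst a ξ t ∂(leb a) + corner a ξ * ∫ t, optSnd a ξ t ∂(leb a)) := by
  set p := corner a ξ with hp
  have hp0 : 0 ≤ p := corner_nonneg ξ
  have hξa : ξ ≤ a := (hξ.2.trans ha).le
  have hpw : p ^ 2 = weight a ξ ^ 2 - 1 := corner_sq ha ξ
  have hwc := continuous_weight ha
  have hqc := continuous_corner ha
  set m : ∀ s z : ℝ, Fin 2 → ℝ := fun s z => T (chi a (measurableSet_Ioc (a := s) (b := z))) with hm
  set L : (Fin 2 → ℝ) → ℝ := fun x => x 0 + p * x 1 with hL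
  have hbd {s z : ℝ} (hs : 0 ≤ s) (hsz : s ≤ z) (hz : z ≤ a) :
      m s z 0 ^ 2 + m s z 1 ^ 2 ≤ (c * ∫ t in s..z, weight a t) ^ 2 ∧
        ∀ i, |m s z i| ≤ c * (z - s) := by
    have := norm_apply_chi_le ha hc hT (measurableSet_Ioc (a := s) (b := z))
    rw [setIntegral_leb hs hsz hz, setIntegral_leb hs hsz hz] at this
    simpa using this
  have hadd {r s z : ℝ} (hrs : r ≤ s) (hsz : s ≤ z) : L (m r z) = L (m r s) + L (m s z) := by
    simp only [hL, hm, chi_add_chi hrs hsz, map_add, Pi.add_apply]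
    ring
  have hint {s z : ℝ} (hsz : s ≤ z) :
      0 ≤ ∫ t in s..z, weight a t ∧ ∫ t in s..z, weight a t ≤ (z - s) * weight a s := by
    refine ⟨intervalIntegral.integral_nonneg hsz fun t _ => (weight_pos ha t).le, ?_⟩
    have := intervalIntegral.integral_mono_on (μ := volume) hsz (hwc.intervalIntegrable s z)
      (intervalIntegrable_const (c := weight a s)) fun t ht => weight_antitone ha ht.1
    simpa using this
  -- The weight is at most its value at the left end `s`, so `m s z` obeys the constraints at `s`,
  -- scaled by `c * (z - s)`.
  have hstep {s z : ℝ} (hs : 0 ≤ s) (hsξ : s ≤ ξ) (hsz : s ≤ z) (hz : z ≤ a) :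
      L (m s z) ≤ c * (z - s) * (1 + p * corner a s) := by
    obtain ⟨h2, h1⟩ := hbd hs hsz hz
    refine add_mul_le_of_norm_le hp0 (corner_antitone ha hsξ)
      (mul_nonneg hc (sub_nonneg.2 hsz)) (weight_pos ha s) (corner_sq ha s)
      ((le_abs_self _).trans (h1 0)) (h2.trans ?_)
    rw [mul_assoc]
    exact pow_le_pow_left₀ (mul_nonneg hc (hint hsz).1)
      (mul_le_mul_of_nonneg_left (hint hsz).2 hc) 2
  have hLip {s z : ℝ} (hs : 0 ≤ s) (hsz : s ≤ z) (hz : z ≤ a) :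
      |L (m 0 z) - L (m 0 s)| ≤ c * (1 + p) * (z - s) := by
    rw [hadd hs hsz, add_sub_cancel_left]
    obtain ⟨-, h1⟩ := hbd hs hsz hz
    calc |L (m s z)| ≤ |m s z 0| + p * |m s z 1| := 
          (abs_add_le _ _).trans_eq (by rw [abs_mul, abs_of_nonneg hp0])
      _ ≤ c * (z - s) + p * (c * (z - s)) := by
          gcongr
          exacts [h1 0, h1 1]
      _ = c * (1 + p) * (z - s) := by ring
  have hcont : ContinuousOn (fun s => L (m 0 s)) (Icc 0 ξ) := by
    refine (LipschitzOnWith.of_dist_le_mul (K := (c * (1 + p)).toNNReal) ?_).continuousOn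
    intro s hs z hz
    rw [Real.coe_toNNReal _ (by positivity), Real.dist_eq, Real.dist_eq]
    rcases le_total s z with h | h
    · rw [abs_sub_comm, abs_sub_comm s z, abs_of_nonneg (sub_nonneg.2 h)]
      exact hLip hs.1 h (hz.2.trans hξa)
    · rw [abs_of_nonneg (sub_nonneg.2 h)]
      exact hLip hz.1 h (hs.2.trans hξa)
  have hkc : Continuous fun t => c * (1 + p * corner a t) := by fun_prop
  -- No density of `T` is used: `hstep` bounds the right slopes of `s ↦ L (m 0 s)` by the continuous
  -- integrand, and a differential inequality integrates this bound.
  have hleft : L (m 0 ξ) ≤ ∫ t in (0 : ℝ)..ξ, c * (1 + p * corner a t) := by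
    refine image_le_of_liminf_slope_right_le_deriv_boundary
      (B := fun s => ∫ t in (0 : ℝ)..s, c * (1 + p * corner a t))
      (B' := fun t => c * (1 + p * corner a t)) hcont ?_ ?_ ?_ ?_ (right_mem_Icc.2 hξ.1.le)
    · have := (hbd le_rfl le_rfl (hξ.1.le.trans hξa)).2
      have h0 : ∀ i, m 0 0 i = 0 := fun i => abs_nonpos_iff.1 (by simpa using this i)
      simp [hL, h0]
    · exact (intervalIntegral.continuous_primitive
        (fun _ _ => hkc.intervalIntegrable _ _) 0).continuousOn
    · exact fun x _ => (hkc.integral_hasStrictDerivAt 0 x).hasDerivAt.hasDerivWithinAt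
    · intro x hx r hr
      refine Eventually.frequently ?_
      filter_upwards [Ioo_mem_nhdsGT hx.2] with z hz
      refine lt_of_le_of_lt ?_ hr
      rw [slope_def_field, hadd hx.1 hz.1.le, add_sub_cancel_left, div_le_iff₀ (sub_pos.2 hz.1)]
      refine (hstep hx.1 hx.2.le hz.1.le (hz.2.le.trans hξa)).trans_eq ?_
      ring
  -- Beyond `ξ` the maximizing direction is constant, so one interval suffices and no subdivision is
  -- needed.
  have hright : L (m ξ a) ≤ c * errFun a ξ * weight a ξ := by
    obtain ⟨h2, -⟩ := hbd hξ.1.le hξa le_rfl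
    rw [integral_weight ha hξ.2.le] at h2
    exact add_mul_le_of_sq_le (mul_nonneg hc (errFun_pos ha ξ).le) (weight_pos ha ξ) hpw h2
  have htot : L (m 0 a) = a + p := by
    simp only [hL, hm, chi_Ioc_eq_const, hT1]
    simp
  rw [← htot, hadd hξ.1.le hξa, integral_optFst ha hξ, integral_optSnd ha hξ]
  refine (add_le_add hleft hright).trans_eq ?_
  rw [intervalIntegral.integral_const_mul, intervalIntegral.integral_add
    intervalIntegrable_const ((hqc.const_mul p).intervalIntegrable 0 ξ),
    intervalIntegral.integral_const_mul]
  have hw := (weight_pos ha ξ).ne'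
  have : errFun a ξ * weight a ξ = errFun a ξ / weight a ξ + p * (errFun a ξ * p / weight a ξ) := by
    field_simp
    linear_combination -errFun a ξ * hpw
  rw [mul_assoc c, this]
  simp
  ring

/-- A bounded pair satisfies pointwise bounds. -/
lemma pointwise_bounds (ha : 1 < a) {g₀ g₁ : ℝ → ℝ} (hg₀ : MemLp g₀ ∞ (leb a))
    (hg₁ : MemLp g₁ ∞ (leb a)) {T : Lp ℝ 1 (leb a) →ₗ[ℝ] (Fin 2 → ℝ)} {c : ℝ} (hc : 0 ≤ c)
    (hT : coupleOpNorm (coupleP a) coupleX T ≤ ENNReal.ofReal c)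
    (hTg : ∀ h, T h = ![∫ t, h t * g₀ t ∂(leb a), ∫ t, h t * g₁ t ∂(leb a)]) :
    ∀ᵐ t ∂(leb a), g₀ t ≤ c ∧ g₀ t ^ 2 + g₁ t ^ 2 ≤ (c * weight a t) ^ 2 := by
  have hi₀ : Integrable g₀ (leb a) := hg₀.integrable le_top
  have hi₁ : Integrable g₁ (leb a) := hg₁.integrable le_top
  have hiw : Integrable (weight a) (leb a) :=
    ((continuous_weight ha).integrableOn_Icc (a := 0) (b := a)).mono_set Ioo_subset_Icc_self
  have hTS {S : Set ℝ} (hS : MeasurableSet S) :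
      T (chi a hS) = ![∫ t in S, g₀ t ∂(leb a), ∫ t in S, g₁ t ∂(leb a)] := by
    rw [hTg, integral_chi_mul, integral_chi_mul]
  have hb₀ : ∀ᵐ t ∂(leb a), g₀ t ≤ c := by
    refine ae_le_of_forall_setIntegral_le hi₀ (integrable_const c) fun S hS _ => ?_
    have := (norm_apply_chi_le ha hc hT hS).2 0
    rw [hTS hS, ← integral_const_mul] at this
    simpa using (le_abs_self _).trans this
  -- Rational directions keep the exceptional set null. Density extends the bound to all real
  -- directions, and the direction `(g₀ t, g₁ t)` itself then gives the Euclidean bound.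
  have hb : ∀ᵐ t ∂(leb a), ∀ x : ℚ × ℚ,
      x.1 * g₀ t + x.2 * g₁ t ≤ √((x.1 : ℝ) ^ 2 + (x.2 : ℝ) ^ 2) * (c * weight a t) := by
    refine ae_all_iff.2 fun x => ?_
    refine ae_le_of_forall_setIntegral_le ((hi₀.const_mul _).add (hi₁.const_mul _))
      ((hiw.const_mul c).const_mul _) fun S hS _ => ?_
    have := (norm_apply_chi_le ha hc hT hS).1
    have hw0 : 0 ≤ c * ∫ t in S, weight a t ∂(leb a) :=
      mul_nonneg hc (integral_nonneg fun t => (weight_pos ha t).le)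
    rw [hTS hS] at this
    simp only [Matrix.cons_val_zero, Matrix.cons_val_one] at this
    rw [integral_add (hi₀.const_mul _).integrableOn (hi₁.const_mul _).integrableOn,
      integral_const_mul, integral_const_mul, integral_const_mul, integral_const_mul]
    refine le_of_sq_le_sq ?_ (mul_nonneg (Real.sqrt_nonneg _) hw0)
    rw [mul_pow, Real.sq_sqrt (by positivity)]
    nlinarith [sq_nonneg ((x.1 : ℝ) * (∫ t in S, g₁ t ∂(leb a)) -
        x.2 * ∫ t in S, g₀ t ∂(leb a)),
      mul_le_mul_of_nonneg_left this (add_nonneg (sq_nonneg (x.1 : ℝ)) (sq_nonneg (x.2 : ℝ)))]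
  filter_upwards [hb₀, hb] with t h0 h1
  refine ⟨h0, ?_⟩
  have hR : 0 ≤ c * weight a t := mul_nonneg hc (weight_pos ha t).le
  have hd : DenseRange (Prod.map ((↑) : ℚ → ℝ) ((↑) : ℚ → ℝ)) :=
    Rat.denseRange_cast.prodMap Rat.denseRange_cast
  have h2 : ∀ x : ℝ × ℝ, x.1 * g₀ t + x.2 * g₁ t ≤ √(x.1 ^ 2 + x.2 ^ 2) * (c * weight a t) :=
    fun x => hd.induction_on x (isClosed_le (by fun_prop) (by fun_prop)) h1
  have h3 := h2 (g₀ t, g₁ t)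
  simp only at h3
  set N := √(g₀ t ^ 2 + g₁ t ^ 2) with hN
  have hN2 : N ^ 2 = g₀ t ^ 2 + g₁ t ^ 2 := Real.sq_sqrt (by positivity)
  rw [← hN2]
  refine pow_le_pow_left₀ (Real.sqrt_nonneg _) ?_ 2
  rcases (Real.sqrt_nonneg _ : 0 ≤ N).eq_or_lt with h | h
  · rwa [← h]
  · refine le_of_mul_le_mul_left ?_ h
    linarith

end Optimal

/-! ### Polar angles, the value of the minimal norm, and uniqueness of the optimal pair -/

section Uniqueness

variable {a ξ : ℝ}

lemma polarAngle_corner (ha : 1 < a) {r : ℝ} (hr : 0 < r) (s : ℝ) :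
    polarAngle r (r * corner a s) = Real.arccos (1 / weight a s) := by
  have hw := weight_pos ha s
  have h1 : √(r ^ 2 + (r * corner a s) ^ 2) = r * weight a s := by
    rw [mul_pow, corner_sq ha, ← Real.sqrt_sq (mul_pos hr hw).le]
    congr 1
    ring
  rw [polarAngle, h1, Real.arccos_eq_arcsin (by positivity), mul_div_mul_left _ _ hr.ne', corner,
    div_pow, one_pow, one_sub_div (by positivity), Real.sqrt_div' _ (by positivity),
    Real.sqrt_sq hw.le]

/-- Up to `ξ` the vector is a multiple of the corner at `t`; afterwards its direction stays frozen
at the corner at `ξ`. -/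
lemma polarAngle_opt (ha : 1 < a) {c : ℝ} (hc : 0 < c) (t : ℝ) :
    polarAngle (c * optFst a ξ t) (c * optSnd a ξ t) =
      Real.arccos (1 / weight a (min t ξ)) := by
  rcases le_or_gt t ξ with h | h
  · rw [min_eq_left h, ← polarAngle_corner ha hc, optFst, optSnd, if_pos h, if_pos h, mul_one]
  · have hr : 0 < c * (weight a t / weight a ξ) :=
      mul_pos hc (div_pos (weight_pos ha t) (weight_pos ha ξ))
    rw [min_eq_right h.le, ← polarAngle_corner ha hr, optFst, optSnd, if_neg h.not_ge,
      if_neg h.not_ge, mul_div_right_comm, mul_assoc]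

/-- Although the weight is constant on `[1, ∞)`, it is strictly smaller at every `t > ξ` than at
`ξ`, because `ξ < 1`. -/
lemma arccos_weight_lt_iff (ha : 1 < a) (hξ : ξ < 1) (t : ℝ) :
    Real.arccos (1 / weight a t) < Real.arccos (1 / weight a (min t ξ)) ↔ ξ < t := by
  rcases le_or_gt t ξ with h | h
  · simp [h]
  · have hm : ∀ s, 1 / weight a s ∈ Icc (-1 : ℝ) 1 := fun s =>
      ⟨by linarith [one_div_pos.2 (weight_pos ha s)],
        (div_le_one (weight_pos ha s)).2 (one_le_weight ha s)⟩
    rw [min_eq_right h.le, Real.strictAntiOn_arccos.lt_iff_gt (hm t) (hm ξ)]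
    exact iff_of_true (one_div_lt_one_div_of_lt (weight_pos ha t) (weight_lt_weight ha hξ h)) h

/-- The norm of the minimal operators. -/
def optConst (a ξ : ℝ) : ℝ := a / ∫ t, optFst a ξ t ∂(leb a)

lemma integral_optFst_pos (ha : 1 < a) (hξ : ξ ∈ Ioo (0 : ℝ) 1) :
    0 < ∫ t, optFst a ξ t ∂(leb a) := by
  rw [integral_optFst ha hξ]
  exact add_pos hξ.1 (div_pos (errFun_pos ha ξ) (weight_pos ha ξ))

lemma optConst_pos (ha : 1 < a) (hξ : ξ ∈ Ioo (0 : ℝ) 1) : 0 < optConst a ξ :=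
  div_pos (by linarith) (integral_optFst_pos ha hξ)

/-- The square root drops out because `errFun a ξ / weight a ξ = errFun a ξ ^ 2 / (a + 1 - 2 * ξ)`.
-/
lemma optConst_eq (ha : 1 < a) (hξ : ξ ∈ Ioo (0 : ℝ) 1) :
    optConst a ξ = (a ^ 2 + a - 2 * a * ξ) / (a ^ 2 - a * ξ + 1 - ξ) := by
  have hd : 0 < a + 1 - 2 * ξ := by linarith [hξ.2]
  have hD : 0 < a ^ 2 - a * ξ + 1 - ξ := by nlinarith [hξ.2, mul_pos (sub_pos.2 ha) (sub_pos.2 hξ.2)]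
  have hE := errFun_pos ha ξ
  have hX : ξ + errFun a ξ / weight a ξ = (a ^ 2 - a * ξ + 1 - ξ) / (a + 1 - 2 * ξ) := by
    rw [weight_of_le_one ha hξ.2.le, div_div_eq_mul_div, ← sq, errFun_sq ha,
      eq_div_iff hd.ne', add_mul, div_mul_cancel₀ _ hd.ne']
    ring
  rw [optConst, integral_optFst ha hξ, hX, div_div_eq_mul_div]
  ring

lemma memLp_mul_opt (ha : 1 < a) {c : ℝ} (hc : 0 ≤ c) :
    MemLp (fun t => c * optFst a ξ t) ∞ (leb a) ∧ MemLp (fun t => c * optSnd a ξ t) ∞ (leb a) := by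
  constructor
  · refine memLp_top_of_bound ((measurable_optFst ha ξ).const_mul c).aestronglyMeasurable c
      (Eventually.of_forall fun t => ?_)
    rw [Real.norm_eq_abs, abs_of_nonneg (mul_nonneg hc (optFst_pos ha ξ t).le)]
    exact mul_le_of_le_one_right hc (optFst_le_one ha ξ t)
  · refine memLp_top_of_bound ((measurable_optSnd ha ξ).const_mul c).aestronglyMeasurable c
      (Eventually.of_forall fun t => ?_)
    rw [Real.norm_eq_abs, abs_of_nonneg (mul_nonneg hc (optSnd_nonneg ha ξ t))]
    exact mul_le_of_le_one_right hc (optSnd_le_one ha ξ t)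

lemma integral_const_one_mul (g : ℝ → ℝ) :
    ∫ t, Lp.const 1 (leb a) (1 : ℝ) t * g t ∂(leb a) = ∫ t, g t ∂(leb a) := by
  refine integral_congr_ae ?_
  filter_upwards [Lp.coeFn_const (p := 1) (μ := leb a) (1 : ℝ)] with t ht
  rw [ht, Function.const_apply, one_mul]

/-- There is a `ξ` for which `optConst a ξ • (optFst a ξ, optSnd a ξ)` has the integral `(a, 1)`. -/
lemma exists_integral_opt (ha : 1 < a) :
    ∃ ξ ∈ Ioo (0 : ℝ) 1, ∫ t, optFst a ξ t ∂(leb a) = a * ∫ t, optSnd a ξ t ∂(leb a) := by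
  obtain ⟨ξ, hξ, h⟩ := exists_switch ha
  exact ⟨ξ, hξ, by rw [integral_optFst ha hξ, integral_optSnd ha hξ, h]⟩

lemma optConst_mul_integral (ha : 1 < a) (hξ : ξ ∈ Ioo (0 : ℝ) 1)
    (h : ∫ t, optFst a ξ t ∂(leb a) = a * ∫ t, optSnd a ξ t ∂(leb a)) :
    optConst a ξ * ∫ t, optFst a ξ t ∂(leb a) = a ∧
      optConst a ξ * ∫ t, optSnd a ξ t ∂(leb a) = 1 := by
  have h1 : optConst a ξ * ∫ t, optFst a ξ t ∂(leb a) = a :=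
    div_mul_cancel₀ _ (integral_optFst_pos ha hξ).ne'
  refine ⟨h1, mul_left_cancel₀ (show a ≠ 0 by linarith) ?_⟩
  rw [mul_left_comm, ← h, h1, mul_one]

lemma exists_minimal (ha : 1 < a) (hξ : ξ ∈ Ioo (0 : ℝ) 1)
    (h : ∫ t, optFst a ξ t ∂(leb a) = a * ∫ t, optSnd a ξ t ∂(leb a)) :
    ∃ T ∈ opSet a, (∀ u, T u = ![∫ t, u t * (optConst a ξ * optFst a ξ t) ∂(leb a),
        ∫ t, u t * (optConst a ξ * optSnd a ξ t) ∂(leb a)]) ∧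
      coupleOpNorm (coupleP a) coupleX T ≤ ENNReal.ofReal (optConst a ξ) := by
  have hc := (optConst_pos ha hξ).le
  obtain ⟨hm₀, hm₁⟩ := memLp_mul_opt (ξ := ξ) ha hc
  have hle : coupleOpNorm (coupleP a) coupleX (pairOp hm₀ hm₁) ≤
      ENNReal.ofReal (optConst a ξ) := by
    refine coupleOpNorm_pairOp_le ha hm₀ hm₁ hc (fun t => ?_) (fun t => ?_) fun t => ?_
    · rw [abs_of_nonneg (mul_nonneg hc (optFst_pos ha ξ t).le)]
      exact mul_le_of_le_one_right hc (optFst_le_one ha ξ t)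
    · rw [abs_of_nonneg (mul_nonneg hc (optSnd_nonneg ha ξ t))]
      exact mul_le_of_le_one_right hc (optSnd_le_one ha ξ t)
    · rw [mul_pow, mul_pow, ← mul_add, optFst_sq_add_optSnd_sq ha, mul_pow]
  refine ⟨pairOp hm₀ hm₁, ⟨hle.trans_lt ENNReal.ofReal_lt_top, ?_⟩, fun u => rfl, hle⟩
  change ![_, _] = _
  obtain ⟨h1, h2⟩ := optConst_mul_integral ha hξ h
  rw [integral_const_one_mul, integral_const_one_mul, integral_const_mul, integral_const_mul,
    h1, h2]

/-- For the balanced `ξ`, the left side `a + corner a ξ` of `add_corner_le` is `optConst a ξ` times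
the factor multiplying `c` on the right, and this positive factor cancels. -/
lemma optConst_le_coupleOpNorm (ha : 1 < a) (hξ : ξ ∈ Ioo (0 : ℝ) 1)
    (h : ∫ t, optFst a ξ t ∂(leb a) = a * ∫ t, optSnd a ξ t ∂(leb a))
    {T : Lp ℝ 1 (leb a) →ₗ[ℝ] (Fin 2 → ℝ)} (hT : T ∈ opSet a) :
    ENNReal.ofReal (optConst a ξ) ≤ coupleOpNorm (coupleP a) coupleX T := by
  have hN : coupleOpNorm (coupleP a) coupleX T =
      ENNReal.ofReal (coupleOpNorm (coupleP a) coupleX T).toReal :=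
    (ENNReal.ofReal_toReal hT.1.ne).symm
  rw [hN]
  have hle := add_corner_le ha hξ ENNReal.toReal_nonneg hN.le hT.2
  obtain ⟨h1, h2⟩ := optConst_mul_integral ha hξ h
  have hX := integral_optFst_pos ha hξ
  have hY : 0 ≤ ∫ t, optSnd a ξ t ∂(leb a) := integral_nonneg fun t => optSnd_nonneg ha ξ t
  refine ENNReal.ofReal_le_ofReal (le_of_mul_le_mul_right ?_
    (add_pos_of_pos_of_nonneg hX (mul_nonneg (corner_nonneg (a := a) ξ) hY)))
  refine le_trans (le_of_eq ?_) hle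
  rw [mul_add, h1, mul_left_comm, h2, mul_one]

lemma cConst_eq (ha : 1 < a) (hξ : ξ ∈ Ioo (0 : ℝ) 1)
    (h : ∫ t, optFst a ξ t ∂(leb a) = a * ∫ t, optSnd a ξ t ∂(leb a)) :
    cConst a = ENNReal.ofReal (optConst a ξ) := by
  refine le_antisymm ?_ (le_iInf₂ fun T hT => optConst_le_coupleOpNorm ha hξ h hT)
  obtain ⟨T, hT, -, hle⟩ := exists_minimal ha hξ h
  exact (iInf₂_le T hT).trans hle

lemma isOptimalPair_opt (ha : 1 < a) (hξ : ξ ∈ Ioo (0 : ℝ) 1)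
    (h : ∫ t, optFst a ξ t ∂(leb a) = a * ∫ t, optSnd a ξ t ∂(leb a)) :
    IsOptimalPair a (fun t => optConst a ξ * optFst a ξ t)
      (fun t => optConst a ξ * optSnd a ξ t) := by
  have hc := (optConst_pos ha hξ).le
  obtain ⟨hm₀, hm₁⟩ := memLp_mul_opt (ξ := ξ) ha hc
  obtain ⟨T, hT, hTu, hle⟩ := exists_minimal ha hξ h
  refine ⟨hm₀, hm₁, Eventually.of_forall fun t => mul_nonneg hc (optFst_pos ha ξ t).le,
    Eventually.of_forall fun t => mul_nonneg hc (optSnd_nonneg ha ξ t), T, hT, hTu, ?_⟩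
  rw [cConst_eq ha hξ h]
  exact le_antisymm hle (optConst_le_coupleOpNorm ha hξ h hT)

/-- The optimal pair is unique up to a null set. -/
lemma IsOptimalPair.ae_eq (ha : 1 < a) (hξ : ξ ∈ Ioo (0 : ℝ) 1)
    (h : ∫ t, optFst a ξ t ∂(leb a) = a * ∫ t, optSnd a ξ t ∂(leb a)) {g₀ g₁ : ℝ → ℝ}
    (hg : IsOptimalPair a g₀ g₁) :
    ∀ᵐ t ∂(leb a), g₀ t = optConst a ξ * optFst a ξ t ∧ g₁ t = optConst a ξ * optSnd a ξ t := by
  obtain ⟨hm₀, hm₁, -, -, T, hT, hTg, hN⟩ := hg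
  set c := optConst a ξ with hc
  set p := corner a ξ with hp
  have hc0 : 0 < c := optConst_pos ha hξ
  have hp0 : 0 < p := corner_pos ha hξ.2
  have hw := weight_pos ha
  have hpw : p ^ 2 = weight a ξ ^ 2 - 1 := corner_sq ha ξ
  rw [cConst_eq ha hξ h] at hN
  have hb := pointwise_bounds ha hm₀ hm₁ hc0.le hN.le hTg
  have hi₀ : Integrable g₀ (leb a) := hm₀.integrable le_top
  have hi₁ : Integrable g₁ (leb a) := hm₁.integrable le_top
  obtain ⟨ho₀, ho₁⟩ := memLp_mul_opt (ξ := ξ) ha hc0.le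
  have hj₀ := ho₀.integrable le_top
  have hj₁ := ho₁.integrable le_top
  have hT1 := hT.2
  rw [hTg, integral_const_one_mul, integral_const_one_mul] at hT1
  have e₀ : ∫ t, g₀ t ∂(leb a) = a := congrFun hT1 0
  have e₁ : ∫ t, g₁ t ∂(leb a) = 1 := congrFun hT1 1
  obtain ⟨h1, h2⟩ := optConst_mul_integral ha hξ h
  have hopt : ∀ t, c * optFst a ξ t + p * (c * optSnd a ξ t) =
      if t ≤ ξ then c * (1 + p * corner a t) else c * weight a t * weight a ξ := by
    intro t
    unfold optFst optSnd
    split_ifs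
    · ring
    · have := (hw ξ).ne'
      field_simp
      linear_combination weight a t * hpw
  have hle : ∀ᵐ t ∂(leb a), g₀ t + p * g₁ t ≤ c * optFst a ξ t + p * (c * optSnd a ξ t) := by
    filter_upwards [hb] with t ht
    rw [hopt]
    split_ifs with htξ
    · exact add_mul_le_of_norm_le hp0.le (corner_antitone ha htξ) hc0.le (hw t) (corner_sq ha t)
        ht.1 ht.2
    · exact add_mul_le_of_sq_le (mul_pos hc0 (hw t)).le (hw ξ) hpw ht.2
  -- Both functions have integral `a + p`, so the pointwise inequality is an equality almost
  -- everywhere.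
  have heq : (fun t => g₀ t + p * g₁ t) =ᵐ[leb a]
      fun t => c * optFst a ξ t + p * (c * optSnd a ξ t) := by
    refine (integral_eq_iff_of_ae_le (hi₀.add (hi₁.const_mul p))
      (hj₀.add (hj₁.const_mul p)) hle).1 ?_
    simp only [Pi.add_apply]
    rw [integral_add hi₀ (hi₁.const_mul p), integral_add hj₀ (hj₁.const_mul p),
      integral_const_mul, integral_const_mul, integral_const_mul, integral_const_mul, e₀, e₁,
      h1, h2]
  -- At `t = ξ` the strict inequality `p < corner a t` needed by `eq_corner_of_add_mul_eq` fails.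
  have hne : ∀ᵐ t ∂(leb a), t ≠ ξ :=
    ae_restrict_of_ae (Measure.ae_ne volume ξ)
  filter_upwards [hb, heq, hne] with t ht het hn
  rw [hopt] at het
  unfold optFst optSnd
  split_ifs at het ⊢ with htξ
  · have hlt : t < ξ := lt_of_le_of_ne htξ hn
    have hpq : p < corner a t := by
      refine lt_of_pow_lt_pow_left₀ 2 (corner_nonneg t) ?_
      rw [hpw, corner_sq ha]
      have := weight_lt_weight ha (hlt.trans hξ.2) hlt
      nlinarith [hw ξ]
    rw [mul_one]
    exact eq_corner_of_add_mul_eq hp0 hpq hc0.le (hw t) (corner_sq ha t) ht.1 ht.2 het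
  · obtain ⟨hx, hy⟩ := eq_mul_div_of_add_mul_eq (hw ξ) hpw ht.2 het
    exact ⟨by rw [hx, mul_div_assoc], by rw [hy]; ring⟩

end Uniqueness

end

end KDiv

/-! ### Assembly: transfer of the explicit optimal pair to the angle set -/

theorem mainTheorem4 :
    (∀ a : ℝ, 1 < a →
      (∃ g₀ g₁ : ℝ → ℝ, KDiv.IsOptimalPair a g₀ g₁) ∧
      ∃ ξ ∈ Set.Ioo (0 : ℝ) 1,
        KDiv.cConst a =
          ENNReal.ofReal ((a ^ 2 + a - 2 * a * ξ) / (a ^ 2 - a * ξ + 1 - ξ)) ∧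
        ∀ g₀ g₁ : ℝ → ℝ, KDiv.IsOptimalPair a g₀ g₁ →
          KDiv.angleSet a g₀ g₁ =ᵐ[MeasureTheory.volume] Set.Ioo ξ a ∧
          ∀ᵐ t ∂MeasureTheory.volume, t ∈ KDiv.angleSet a g₀ g₁ →
            KDiv.polarAngle (g₀ t) (g₁ t) = Real.arccos (1 / KDiv.weight a ξ)) ∧
    KDiv.kDivisibility KDiv.coupleX ≤
      ENNReal.ofReal ((4 + 3 * √2) / (4 + 2 * √2)) := by
  refine ⟨fun a ha => ?_, KDiv.kDivisibility_coupleX_le⟩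
  obtain ⟨ξ, hξ, h⟩ := KDiv.exists_integral_opt ha
  refine ⟨⟨_, _, KDiv.isOptimalPair_opt ha hξ h⟩, ξ, hξ, ?_, fun g₀ g₁ hg => ?_⟩
  · rw [KDiv.cConst_eq ha hξ h, KDiv.optConst_eq ha hξ]
  have hc := KDiv.optConst_pos ha hξ
  have hae := (ae_restrict_iff' measurableSet_Ioo).1 (KDiv.IsOptimalPair.ae_eq ha hξ h hg)
  have hmem : ∀ᵐ t ∂volume, t ∈ Ioo 0 a →
      KDiv.polarAngle (g₀ t) (g₁ t) = Real.arccos (1 / KDiv.weight a (min t ξ)) := by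
    filter_upwards [hae] with t ht hta
    rw [(ht hta).1, (ht hta).2, KDiv.polarAngle_opt ha hc]
  have hset : ∀ᵐ t ∂volume, t ∈ KDiv.angleSet a g₀ g₁ ↔ t ∈ Ioo ξ a := by
    filter_upwards [hmem] with t ht
    constructor
    · rintro ⟨hta, hlt⟩
      rw [ht hta, KDiv.arccos_weight_lt_iff ha hξ.2] at hlt
      exact ⟨hlt, hta.2⟩
    · intro hta
      have hta' : t ∈ Ioo 0 a := ⟨hξ.1.trans hta.1, hta.2⟩
      refine ⟨hta', ?_⟩
      rw [ht hta', KDiv.arccos_weight_lt_iff ha hξ.2]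
      exact hta.1
  refine ⟨hset.mono fun t ht => propext ht, ?_⟩
  filter_upwards [hmem, hset] with t ht hts htU
  rw [ht htU.1, min_eq_right (hts.1 htU).1.le]
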